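/- **Theorem 3.3.** Let $\mathbb F$ be a finite field, let $n\ge 1$ be not divisible by $\operatorname{char}\mathbb F$, and let $A=\mathbb F[x]/\langle x^n-1\rangle$. Let $E\subseteq A$ be the set of primitive idempotents of $A$: for each monic prime factor $\pi$ of $x^n-1$ it contains the unique $\varepsilon\in A$ with $\varepsilon\equiv 1 \bmod \pi$ and $\varepsilon\equiv 0\bmod\pi'$ for every other monic prime factor $\pi'$ of $x^n-1$. Let $\sigma$ be an $\mathbb F$-algebra automorphism of $A$, let $\emptyset\neq S\subseteq E$, and let $m,b\in\mathbb N$ be such that $S\cap\sigma^j(S)=\emptyset$ for all $1\le j\le b$ and $1\le m\le b$. Put $c=\sum_{\varepsilon\in S}\varepsilon$ and $k=\dim_{\mathbb F}\langle c\rangle$, where $\langle c\rangle\subseteq A$ is the ideal generated by $c$. Let $A[z;\sigma]$ be the skew polynomial ring with elements $\sum_\nu z^\nu a_\nu$ ($a_\nu\in A$) and multiplication determined by $az=z\sigma(a)$ for $a\in A$; it is a left $\mathbb F[z]$-module. Let $\mathfrak v:A\to\mathbb F^n$ be the inverse of $(v_0,\dots,v_{n-1})\mapsto\sum_i v_ix^i$,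 extended to the isomorphism of left $\mathbb F[z]$-modules $\mathfrak v:A[z;\sigma]\to\mathbb F[z]^n$, $\sum_\nu z^\nu a_\nu\mapsto\sum_\nu z^\nu\mathfrak v(a_\nu)$. Define $$g=c\sum_{\nu=0}^m z^\nu=\sum_{\nu=0}^m z^\nu\sigma^\nu(c)\in A[z;\sigma],\qquad G=\sum_{\nu=0}^m z^\nu G_\nu\in\mathbb F[z]^{k\times n},$$ where $G_\nu\in\mathbb F^{k\times n}$ has the rows $\mathfrak v(\sigma^\nu(c)),\mathfrak v(\sigma^\nu(xc)),\dots,\mathfrak v(\sigma^\nu(x^{k-1}c))$, and let $\mathcal C=\operatorname{im}G=\{wG\mid w\in\mathbb F[z]^k\}$. Then: (a) $g=c\,(1+z\sigma(c))(1+z\sigma^2(c))\cdots(1+z\sigma^m(c))$. (b) $gu=c$ for $u=(1-z\sigma^m(c))(1-z\sigma^{m-1}(c))\cdots(1-z\sigma(c))$; moreover $u$ is a unit of $A[z;\sigma]$ and $u=1-z\big(\sigma(c)+\dots+\sigma^m(c)\big)$. (c) $\mathcal C=\mathfrak v(\{fg\mid f\in A[z;\sigma]\})$. Thus $\mathcal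 C$ is $\sigma$-cyclic, i.e. $\mathfrak v^{-1}(\mathcal C)$ is a left ideal of $A[z;\sigma]$. Moreover $\operatorname{rank}_{\mathbb F[z]}\mathcal C=k$. (d) $\mathcal C$ is a direct summand of $\mathbb F[z]^n$, and $G$ is right invertible over $\mathbb F[z]$; so $\mathcal C$ is a $\sigma$-cyclic convolutional code. (e) $G$ is minimal: it has rank $k$, and the maximal degree of its $k\times k$ minors (its overall constraint length) equals the sum of its row degrees, where the degree of a polynomial row vector is the maximal degree of its entries. (f) $\mathcal C$ is a convolutional code with parameters $(n,k,km)$, i.e. the row module of a right invertible $k\times n$ matrix over $\mathbb F[z]$ with overall constraint length $km$. All $k$ Forney indices of $\mathcal C$ (the row degrees of any minimal matrix with row module $\mathcal C$) are equal to $m$; in particular its memory, the largest Forney index, is $m$. -/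

import Mathlib

open Polynomial

noncomputable section

namespace DoublyCyclicCode

/-! ### The Piret algebra `A[z;σ]` -/

section Piret

variable {F A : Type*} [Field F] [CommRing A] [Algebra F A]

/-- The action of the monoid `ℕ` on `A` through the powers of `σ⁻¹`. -/
@[reducible] def twistAction (σ : A ≃ₐ[F] A) : MulSemiringAction (Multiplicative ℕ) A :=
  MulSemiringAction.compHom A (powersHom (A ≃ₐ[F] A) σ⁻¹)

/-- The skew polynomial ring `A[z;σ]` with the multiplication rule `a z = z σ(a)`.
Mathlib's skew polynomials obey the rule `z a = φ(a) z`, so here `φ = σ⁻¹`;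
see `PiretAlgebra.coe_mul_z`. -/
def PiretAlgebra (_σ : A ≃ₐ[F] A) : Type _ := SkewPolynomial A

namespace PiretAlgebra

variable (σ : A ≃ₐ[F] A)

instance : Ring (PiretAlgebra σ) :=
  letI := twistAction σ
  inferInstanceAs (Ring (SkewPolynomial A))

/-- The embedding of `A` into `A[z;σ]` as constants. -/
def ι : A →+* PiretAlgebra σ :=
  letI := twistAction σ
  SkewPolynomial.CRingHom

/-- The indeterminate `z`. -/
def z : PiretAlgebra σ := (SkewPolynomial.X : SkewPolynomial A)

theorem phi_iterate (k : ℕ) (a : A) :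
    (letI := twistAction σ; (SkewPolynomial.φ (R := A))^[k] a) = (σ⁻¹ ^ k) a := by
  let := twistAction σ
  rw [SkewPolynomial.φ_iterate_apply]
  rfl

/-- The defining rule `a z = z σ(a)`. -/
theorem coe_mul_z (a : A) : ι σ a * z σ = z σ * ι σ (σ a) := by
  let := twistAction σ
  have h := phi_iterate σ 1 (σ a)
  have h1 : (SkewPolynomial.C a : SkewPolynomial A) * SkewPolynomial.monomial 1 1
      = SkewPolynomial.monomial 1 1 * SkewPolynomial.C (σ a) := by
    rw [SkewPolynomial.C_mul_monomial, SkewPolynomial.monomial_mul_C, h]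
    simp
  exact h1

theorem z_pow_mul_coe (k : ℕ) (a : A) :
    z σ ^ k * ι σ a = (SkewPolynomial.monomial k ((σ⁻¹ ^ k) a) : SkewPolynomial A) := by
  let := twistAction σ
  have h1 : (SkewPolynomial.X : SkewPolynomial A) ^ k * SkewPolynomial.C a
      = SkewPolynomial.monomial k ((σ⁻¹ ^ k) a) := by
    rw [← SkewPolynomial.monomial_one_right_eq_X_pow, SkewPolynomial.monomial_mul_C,
      phi_iterate, one_mul]
  exact h1

/-- The embedding of the commutative polynomial ring `F[z]` into `A[z;σ]`. -/
def polyHom : F[X] →+* PiretAlgebra σ :=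
  Polynomial.eval₂RingHom' ((ι σ).comp (algebraMap F A)) (z σ) fun a => by
    change ι σ (algebraMap F A a) * z σ = z σ * ι σ (algebraMap F A a)
    rw [coe_mul_z, AlgEquiv.commutes]

/-- `A[z;σ]` as a left `F[z]`-module, through left multiplication. -/
instance : Module F[X] (PiretAlgebra σ) := Module.compHom _ (polyHom σ)

theorem smul_def (f : F[X]) (h : PiretAlgebra σ) : f • h = polyHom σ f * h := rfl

end PiretAlgebra

end Piret

/-! ### The algebra `A = F[x]/⟨xⁿ - 1⟩` and the maps `𝔭` and `𝔳` -/

section Cyclic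

variable (F : Type*) [Field F] (n : ℕ)

/-- `A = F[x]/⟨xⁿ - 1⟩`. -/
abbrev CyclicAlgebra : Type _ := AdjoinRoot (X ^ n - 1 : F[X])

/-- The class of `x` in `A`. -/
abbrev CyclicAlgebra.x : CyclicAlgebra F n := AdjoinRoot.root (X ^ n - 1 : F[X])

/-- The linear map `Fⁿ → A`, `(v₀, …, vₙ₋₁) ↦ ∑ vᵢ xⁱ`. -/
def pLin₀ : (Fin n → F) →ₗ[F] CyclicAlgebra F n :=
  Fintype.linearCombination F fun i : Fin n => CyclicAlgebra.x F n ^ (i : ℕ)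

theorem pLin₀_bijective [NeZero n] : Function.Bijective (pLin₀ F n) := by
  have hm : (X ^ n - 1 : F[X]).Monic := by
    simpa using monic_X_pow_sub_C (1 : F) (NeZero.ne n)
  have hd : (X ^ n - 1 : F[X]).natDegree = n := by
    simpa using natDegree_X_pow_sub_C (n := n) (r := (1 : F))
  have hpd : (AdjoinRoot.powerBasis' hm).dim = n := hd
  let B := (AdjoinRoot.powerBasis' hm).basis.reindex (finCongr hpd)
  have hB : (B.equivFun.symm : (Fin n → F) →ₗ[F] CyclicAlgebra F n) = pLin₀ F n := by
    ext i
    simp [B, pLin₀, Fintype.linearCombination_apply, Pi.single_apply]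
  rw [← hB]
  exact B.equivFun.symm.bijective

/-- The isomorphism `𝔭 : Fⁿ → A`, `(v₀, …, vₙ₋₁) ↦ ∑ vᵢ xⁱ`. -/
def p₀ [NeZero n] : (Fin n → F) ≃ₗ[F] CyclicAlgebra F n :=
  LinearEquiv.ofBijective (pLin₀ F n) (pLin₀_bijective F n)

theorem p₀_apply [NeZero n] (v : Fin n → F) :
    p₀ F n v = ∑ i : Fin n, v i • CyclicAlgebra.x F n ^ (i : ℕ) := rfl

/-- The coordinate map `𝔳 = 𝔭⁻¹ : A → Fⁿ`. -/
def v₀ [NeZero n] : CyclicAlgebra F n ≃ₗ[F] (Fin n → F) := (p₀ F n).symm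

variable {F n}
variable (σ : CyclicAlgebra F n ≃ₐ[F] CyclicAlgebra F n)

/-- The `F[z]`-linear map `F[z]ⁿ → A[z;σ]`, `(w₀, …, wₙ₋₁) ↦ ∑ wᵢ xⁱ`. -/
def pLin : (Fin n → F[X]) →ₗ[F[X]] PiretAlgebra σ :=
  Fintype.linearCombination F[X] fun i : Fin n =>
    PiretAlgebra.ι σ (CyclicAlgebra.x F n ^ (i : ℕ))

/-- Coefficients stand to the right of `z`: `𝔭(z^ν v) = z^ν 𝔭(v)` for `v ∈ Fⁿ`. -/
theorem pLin_monomial [NeZero n] (k : ℕ) (v : Fin n → F) :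
    pLin σ (fun i => monomial k (v i)) = PiretAlgebra.z σ ^ k * PiretAlgebra.ι σ (p₀ F n v) := by
  rw [pLin, Fintype.linearCombination_apply, p₀_apply, map_sum, Finset.mul_sum]
  refine Finset.sum_congr rfl fun i _ => ?_
  rw [PiretAlgebra.smul_def, ← C_mul_X_pow_eq_monomial, ← X_pow_mul, map_mul, map_pow, mul_assoc,
    Algebra.smul_def, map_mul]
  simp [PiretAlgebra.polyHom]

theorem pLin_coeff [NeZero n] (w : Fin n → F[X]) (k : ℕ) :
    SkewPolynomial.coeff (pLin σ w : SkewPolynomial (CyclicAlgebra F n)) k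
      = (σ⁻¹ ^ k) (p₀ F n fun i => (w i).coeff k) := by
  let L₁ : (Fin n → F[X]) →+ CyclicAlgebra F n :=
    { toFun := fun w => SkewPolynomial.coeff
        (pLin σ w : SkewPolynomial (CyclicAlgebra F n)) k
      map_zero' := by rw [map_zero]; rfl
      map_add' := fun a b => by rw [map_add]; exact SkewPolynomial.coeff_add _ _ _ }
  let L₂ : (Fin n → F[X]) →+ CyclicAlgebra F n :=
    { toFun := fun w => (σ⁻¹ ^ k) (p₀ F n fun i => (w i).coeff k)
      map_zero' := by
        have : (fun i : Fin n => ((0 : Fin n → F[X]) i).coeff k) = 0 := by ext; simp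
        rw [this, map_zero, map_zero]
      map_add' := fun a b => by
        rw [← map_add, ← map_add]
        refine congrArg _ (congrArg _ ?_)
        ext i
        simp }
  suffices h : L₁ = L₂ from DFunLike.congr_fun h w
  refine AddMonoidHom.functions_ext' _ _ _ ?_
  intro i
  ext j a
  change SkewPolynomial.coeff (pLin σ (Pi.single i (monomial j a)) :
      SkewPolynomial (CyclicAlgebra F n)) k
    = (σ⁻¹ ^ k) (p₀ F n fun l => ((Pi.single i (monomial j a) : Fin n → F[X]) l).coeff k)
  have hs : (Pi.single i (monomial j a) : Fin n → F[X])
      = fun l => monomial j ((Pi.single i a : Fin n → F) l) := by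
    ext l : 1
    by_cases hl : l = i
    · subst hl; simp
    · simp [hl]
  rw [hs, pLin_monomial, PiretAlgebra.z_pow_mul_coe, SkewPolynomial.coeff_monomial]
  split_ifs with hjk
  · subst hjk
    simp
  · have : (fun l => (monomial j ((Pi.single i a : Fin n → F) l)).coeff k) = 0 := by
      ext l; simp [coeff_monomial, hjk]
    rw [this, map_zero, map_zero]

theorem pLin_bijective [NeZero n] : Function.Bijective (pLin σ) := by
  constructor
  · rw [injective_iff_map_eq_zero]
    intro w hw
    have h : ∀ k, (fun i => (w i).coeff k) = 0 := by
      intro k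
      have h1 := pLin_coeff σ w k
      rw [hw] at h1
      have h2 : (0 : CyclicAlgebra F n) = (σ⁻¹ ^ k) (p₀ F n fun i => (w i).coeff k) := h1
      simpa using h2.symm
    ext i k
    simpa using congrFun (h k) i
  · intro f
    rw [← LinearMap.mem_range]
    refine SkewPolynomial.induction (motive := fun f => (f : PiretAlgebra σ) ∈ LinearMap.range (pLin σ))
      f (Submodule.zero_mem _) ?_
    intro k a q _ _ hq
    refine Submodule.add_mem _ ⟨fun i => monomial k (v₀ F n ((σ ^ k) a) i), ?_⟩ hq
    rw [pLin_monomial, PiretAlgebra.z_pow_mul_coe]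
    have h : (σ⁻¹ ^ k) (p₀ F n fun i => v₀ F n ((σ ^ k) a) i) = a := by
      change (σ⁻¹ ^ k) (p₀ F n ((p₀ F n).symm ((σ ^ k) a))) = a
      rw [LinearEquiv.apply_symm_apply, ← AlgEquiv.mul_apply, inv_pow, inv_mul_cancel]
      rfl
    rw [h]

/-- The isomorphism of left `F[z]`-modules `𝔭 : F[z]ⁿ → A[z;σ]`,
`∑ z^ν v_ν ↦ ∑ z^ν 𝔭(v_ν)` for `v_ν ∈ Fⁿ`. -/
def p [NeZero n] : (Fin n → F[X]) ≃ₗ[F[X]] PiretAlgebra σ :=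
  LinearEquiv.ofBijective (pLin σ) (pLin_bijective σ)

/-- The isomorphism `𝔳 = 𝔭⁻¹ : A[z;σ] → F[z]ⁿ`. -/
def v [NeZero n] : PiretAlgebra σ ≃ₗ[F[X]] (Fin n → F[X]) := (p σ).symm

end Cyclic

/-! ### Convolutional codes -/

section Codes

variable {F : Type*} [Field F] {k n : ℕ}

/-- `im G = {w G | w ∈ F[z]^k}`, the row module of `G`. -/
def im (G : Matrix (Fin k) (Fin n) F[X]) : Submodule F[X] (Fin n → F[X]) :=
  LinearMap.range G.vecMulLinear

/-- `G` is right invertible over `F[z]`. -/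
def RightInvertible (G : Matrix (Fin k) (Fin n) F[X]) : Prop :=
  ∃ H : Matrix (Fin n) (Fin k) F[X], G * H = 1

/-- The overall constraint length: the maximal degree of the `k`-minors of `G`
(the zero polynomial has degree `⊥`). -/
def overallConstraintLength (G : Matrix (Fin k) (Fin n) F[X]) : WithBot ℕ :=
  Finset.univ.sup fun f : Fin k ↪o Fin n => (G.submatrix id f).det.degree

/-- The degree of a polynomial vector: the maximal degree of its components. -/
def vecDegree (w : Fin n → F[X]) : WithBot ℕ := Finset.univ.sup fun j => (w j).degree

/-- `C ⊆ F[z]ⁿ` is a convolutional code with parameters `(n, k, δ)`. -/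
def IsConvolutionalCode (C : Submodule F[X] (Fin n → F[X])) (k δ : ℕ) : Prop :=
  ∃ G : Matrix (Fin k) (Fin n) F[X],
    RightInvertible G ∧ C = im G ∧ overallConstraintLength G = δ

/-- `G ∈ F[z]^{k×n}` has rank `k` and its overall constraint length is the sum of its
row degrees. -/
def IsMinimal (G : Matrix (Fin k) (Fin n) F[X]) : Prop :=
  G.rank = k ∧ overallConstraintLength G = ∑ i, vecDegree (G i)

/-- `ν` is the multiset of Forney indices of `C`: the row degrees of a minimal matrix
with row module `C`. -/
def IsForneyIndices (C : Submodule F[X] (Fin n → F[X])) (ν : Multiset (WithBot ℕ)) : Prop :=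
  ∃ (k : ℕ) (G : Matrix (Fin k) (Fin n) F[X]),
    IsMinimal G ∧ im G = C ∧ ν = Finset.univ.val.map fun i => vecDegree (G i)

/-- `μ` is the memory of `C`: its largest Forney index. -/
def IsMemory (C : Submodule F[X] (Fin n → F[X])) (μ : ℕ) : Prop :=
  ∃ ν, IsForneyIndices C ν ∧ IsGreatest {d | d ∈ ν} (μ : WithBot ℕ)

/-- `C` is `σ`-cyclic: `𝔭(C)` is a left ideal of `A[z;σ]`
(`Ideal` means left ideal in a noncommutative ring). -/
def IsSigmaCyclic [NeZero n] (σ : CyclicAlgebra F n ≃ₐ[F] CyclicAlgebra F n)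
    (C : Submodule F[X] (Fin n → F[X])) : Prop :=
  ∃ I : Ideal (PiretAlgebra σ), (I : Set (PiretAlgebra σ)) = p σ '' C

end Codes

/-! ### Primitive idempotents and doubly-cyclic codes -/

section DoublyCyclic

variable (F : Type*) [Field F] (n : ℕ)

/-- The monic prime factors of `xⁿ - 1`. -/
def primeFactors : Set F[X] := {π | π.Monic ∧ Irreducible π ∧ π ∣ X ^ n - 1}

/-- The set `E` of the primitive idempotents of `A`: those `ε` such that, for some prime
factor `π` of `xⁿ - 1`, `ε ≡ 1 mod π` and `ε ≡ 0 mod π'` for all other prime factors `π'`. -/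
def primitiveIdempotents : Set (CyclicAlgebra F n) :=
  {ε | ∃ π ∈ primeFactors F n, AdjoinRoot.mk (X ^ n - 1) π ∣ ε - 1 ∧
    ∀ π' ∈ primeFactors F n, π' ≠ π → AdjoinRoot.mk (X ^ n - 1) π' ∣ ε}

variable {F n}

/-- `k = dim_F ⟨c⟩`, the dimension of the cyclic block code generated by `c`. -/
def blockDim (c : CyclicAlgebra F n) : ℕ :=
  Module.finrank F ((Ideal.span {c}).restrictScalars F)

variable (σ : CyclicAlgebra F n ≃ₐ[F] CyclicAlgebra F n) (c : CyclicAlgebra F n)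

/-- The matrix `G_ν ∈ F^{k×n}` with rows `𝔳(σ^ν(xⁱ c))`, `0 ≤ i < k`. -/
def coeffMatrix [NeZero n] (ν : ℕ) : Matrix (Fin (blockDim c)) (Fin n) F :=
  Matrix.of fun i => v₀ F n ((σ ^ ν) (CyclicAlgebra.x F n ^ (i : ℕ) * c))

/-- `G = ∑_{ν=0}^m z^ν G_ν ∈ F[z]^{k×n}`. -/
def genMatrix [NeZero n] (m : ℕ) : Matrix (Fin (blockDim c)) (Fin n) F[X] :=
  ∑ ν ∈ Finset.range (m + 1), (X ^ ν : F[X]) • (coeffMatrix σ c ν).map C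

/-- `g = ∑_{ν=0}^m z^ν σ^ν(c) ∈ A[z;σ]`. -/
def genPoly (m : ℕ) : PiretAlgebra σ :=
  ∑ ν ∈ Finset.range (m + 1), PiretAlgebra.z σ ^ ν * PiretAlgebra.ι σ ((σ ^ ν) c)

/-- `u = (1 - zσ^m(c))(1 - zσ^{m-1}(c))⋯(1 - zσ(c)) ∈ A[z;σ]`. -/
def genUnit (m : ℕ) : PiretAlgebra σ :=
  ((List.range' 1 m).reverse.map fun ν =>
    1 - PiretAlgebra.z σ * PiretAlgebra.ι σ ((σ ^ ν) c)).prod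

end DoublyCyclic

end DoublyCyclicCode

end

open DoublyCyclicCode

/-!
The translates `c, σ(c), …, σ^m(c)` of the idempotent `c` are pairwise orthogonal. Hence the factors
`1 + z σ^ν(c)` and `1 - z σ^ν(c)` are inverse to each other, so that `u` is a unit, and `g u = c`
follows by telescoping. Right multiplication by `u` carries the rows of `G` to those of the constant
matrix `G₀`, which has full row rank because the first `dim ⟨c⟩` cyclic shifts of `c` are a basis
of `⟨c⟩`; a right inverse of `G₀` therefore yields one of `G`. The automorphism `σ^m` carries the
rows of `G₀` to those of the coefficient matrix `G_m` of `z^m`, which thus has full row rank too: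
`G` is row reduced with all row degrees equal to `m`. By the predictable degree property, every
minimal matrix with the same row module has the same row degrees.
-/

namespace DoublyCyclicCode

/-! ### Row reduced polynomial matrices -/

section DegreeBounds

variable {R ι : Type*} [CommRing R]

theorem coeff_prod_sum_of_natDegree_le {s : Finset ι} {f : ι → R[X]} {d : ι → ℕ}
    (h : ∀ i ∈ s, (f i).natDegree ≤ d i) :
    (∏ i ∈ s, f i).coeff (∑ i ∈ s, d i) = ∏ i ∈ s, (f i).coeff (d i) := by
  classical
  induction s using Finset.induction_on with
  | empty => simp
  | insert i s hi ih =>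
    have hs : ∀ j ∈ s, (f j).natDegree ≤ d j := fun j hj => h j (Finset.mem_insert_of_mem hj)
    rw [Finset.prod_insert hi, Finset.sum_insert hi, Finset.prod_insert hi,
      coeff_mul_add_eq_of_natDegree_le (h i (Finset.mem_insert_self i s))
        ((natDegree_prod_le s f).trans (Finset.sum_le_sum hs)), ih hs]

variable [Fintype ι] [DecidableEq ι] {M : Matrix ι ι R[X]} {d : ι → ℕ}

theorem natDegree_det_le_sum (hM : ∀ i j, (M i j).natDegree ≤ d i) :
    M.det.natDegree ≤ ∑ i, d i := by
  rw [Matrix.det_apply]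
  refine natDegree_sum_le_of_forall_le _ _ fun τ _ => (natDegree_smul_le _ _).trans ?_
  calc (∏ i, M (τ i) i).natDegree
      ≤ ∑ i, (M (τ i) i).natDegree := natDegree_prod_le _ _
    _ ≤ ∑ i, d (τ i) := Finset.sum_le_sum fun i _ => hM _ _
    _ = ∑ i, d i := Equiv.sum_comp τ d

theorem coeff_det_sum (hM : ∀ i j, (M i j).natDegree ≤ d i) :
    M.det.coeff (∑ i, d i) = (Matrix.of fun i j => (M i j).coeff (d i)).det := by
  rw [Matrix.det_apply, Matrix.det_apply, finsetSum_coeff]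
  refine Finset.sum_congr rfl fun τ _ => ?_
  rw [coeff_smul, ← Equiv.sum_comp τ d, coeff_prod_sum_of_natDegree_le fun i _ => hM _ _]
  rfl

end DegreeBounds

theorem exists_perm_forall_ne_zero {R ι : Type*} [CommRing R] [Fintype ι] [DecidableEq ι]
    {M : Matrix ι ι R} (hM : M.det ≠ 0) : ∃ τ : Equiv.Perm ι, ∀ i, M (τ i) i ≠ 0 := by
  rw [Matrix.det_apply] at hM
  obtain ⟨τ, -, hτ⟩ := Finset.exists_ne_zero_of_sum_ne_zero hM
  exact ⟨τ, fun i hi =>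
    hτ (smul_eq_zero_of_right _ (Finset.prod_eq_zero (Finset.mem_univ i) hi))⟩

section FieldMatrices

variable {K : Type*} [Field K] {k n : ℕ} {M : Matrix (Fin k) (Fin n) K}

theorem exists_submatrix_det_ne_zero (hM : LinearIndependent K M.row) :
    ∃ f : Fin k ↪o Fin n, (M.submatrix id f).det ≠ 0 := by
  classical
  obtain ⟨s, -, -, hspan, hs⟩ :=
    exists_linearIndepOn_extension (linearIndepOn_empty K M.col) (Set.empty_subset Set.univ)
  have hcard : s.toFinset.card = k := by
    rw [Set.toFinset_card, ← finrank_span_eq_card hs, ← Set.image_eq_range,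
      ← Submodule.span_eq_span hspan
        ((Set.image_mono (Set.subset_univ s)).trans Submodule.subset_span),
      Set.image_univ, ← Matrix.rank_eq_finrank_span_cols, hM.rank_matrix, Fintype.card_fin]
  let f := s.toFinset.orderEmbOfFin hcard
  have hf : ∀ i, f i ∈ s := fun i =>
    Set.mem_toFinset.mp (s.toFinset.orderEmbOfFin_mem hcard i)
  have hcols : LinearIndependent K (M.submatrix id f).col :=
    hs.comp (Set.codRestrict f s hf) (f.injective.codRestrict hf)
  exact ⟨f, ((Matrix.isUnit_iff_isUnit_det _).mp
    (Matrix.linearIndependent_cols_iff_isUnit.mp hcols)).ne_zero⟩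

theorem exists_mul_eq_one (hM : LinearIndependent K M.row) :
    ∃ H : Matrix (Fin n) (Fin k) K, M * H = 1 := by
  rw [← Matrix.mulVec_surjective_iff_exists_right_inverse, ← Matrix.coe_mulVecLin,
    ← LinearMap.range_eq_top]
  apply Submodule.eq_top_of_finrank_eq
  rw [Module.finrank_fin_fun]
  exact hM.rank_matrix.trans (Fintype.card_fin k)

end FieldMatrices

section RowModules

variable {F : Type*} [Field F] {k l n : ℕ} {G : Matrix (Fin k) (Fin n) F[X]}
  {G' : Matrix (Fin l) (Fin n) F[X]}

theorem im_eq_span_rows (G : Matrix (Fin k) (Fin n) F[X]) :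
    im G = Submodule.span F[X] (Set.range G.row) :=
  range_vecMulLinear G

theorem exists_mul_eq_of_im_le (h : im G' ≤ im G) :
    ∃ U : Matrix (Fin l) (Fin k) F[X], U * G = G' := by
  choose U hU using fun i =>
    h ((im_eq_span_rows G').ge (Submodule.subset_span (Set.mem_range_self i)))
  exact ⟨Matrix.of U, funext hU⟩

theorem rank_le_of_im_le (h : im G' ≤ im G) : G'.rank ≤ G.rank := by
  obtain ⟨U, rfl⟩ := exists_mul_eq_of_im_le h
  exact Matrix.rank_mul_le_right U G

theorem overallConstraintLength_mul {U : Matrix (Fin k) (Fin k) F[X]} (hU : IsUnit U.det) :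
    overallConstraintLength (U * G) = overallConstraintLength G := by
  refine Finset.sup_congr rfl fun f _ => ?_
  have hsub : (U * G).submatrix id f = U * G.submatrix id f := by
    simpa using Matrix.submatrix_mul U G id id f Function.bijective_id
  rw [hsub, Matrix.det_mul, degree_mul, degree_eq_zero_of_isUnit hU, zero_add]

theorem degree_le_vecDegree (w : Fin n → F[X]) (j : Fin n) : (w j).degree ≤ vecDegree w :=
  Finset.le_sup (f := fun j => (w j).degree) (Finset.mem_univ j)

theorem rightInvertible_of_linearMap (L : (Fin n → F[X]) →ₗ[F[X]] (Fin k → F[X]))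
    (hL : ∀ i, L (G i) = Pi.single i 1) : RightInvertible G := by
  refine ⟨(LinearMap.toMatrix' L).transpose, funext fun i => ?_⟩
  rw [Matrix.mul_apply_eq_vecMul, Matrix.vecMul_transpose, LinearMap.toMatrix'_mulVec, hL]
  exact funext fun j => (Matrix.one_eq_pi_single (i := i) (j := j)).symm

theorem RightInvertible.exists_isCompl (hG : RightInvertible G) :
    ∃ D : Submodule F[X] (Fin n → F[X]), IsCompl (im G) D := by
  obtain ⟨H, hH⟩ := hG
  refine ⟨_, LinearMap.isCompl_of_proj
    (f := G.vecMulLinear.rangeRestrict ∘ₗ H.vecMulLinear) ?_⟩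
  rintro ⟨_, w, rfl⟩
  ext1
  simp [Matrix.vecMul_vecMul, hH]

end RowModules

theorem eq_of_sum_eq_sum_of_le {ι : Type*} [Fintype ι] {d : ι → ℕ} {e : ι → WithBot ℕ}
    (hle : ∀ i, d i ≤ e i) (hsum : ∑ i, e i = (∑ i, d i : ℕ)) (i : ι) : e i = d i := by
  lift e to ι → ℕ using fun i => (WithBot.bot_lt_coe (d i)).trans_le (hle i) |>.ne'
  have hle' : ∀ i, d i ≤ e i := fun i => WithBot.coe_le_coe.mp (hle i)
  have hsum' : ∑ i, e i = ∑ i, d i :=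
    WithBot.coe_injective ((WithBot.coe_sum _ _).trans hsum)
  exact congrArg _ ((Finset.sum_eq_sum_iff_of_le fun i _ => hle' i).mp hsum'.symm i
    (Finset.mem_univ i)).symm

section RowReduced

variable {F : Type*} [Field F] {k n : ℕ} {G : Matrix (Fin k) (Fin n) F[X]} {d : Fin k → ℕ}

/-- `G` is row reduced with row degrees `d`: the entries of row `i` have degree at most `d i`,
and the coefficients of `z ^ d i` in the rows `i` form a matrix of full row rank. -/
structure IsRowReduced (G : Matrix (Fin k) (Fin n) F[X]) (d : Fin k → ℕ) : Prop where
  natDegree_le : ∀ i j, (G i j).natDegree ≤ d i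
  linearIndependent : LinearIndependent F fun i j => (G i j).coeff (d i)

namespace IsRowReduced

theorem vecDegree_row (hG : IsRowReduced G d) (i : Fin k) : vecDegree (G i) = d i := by
  refine le_antisymm
    (Finset.sup_le fun j _ => natDegree_le_iff_degree_le.mp (hG.natDegree_le i j)) ?_
  obtain ⟨j, hj⟩ := Function.ne_iff.mp (hG.linearIndependent.ne_zero i)
  exact (le_degree_of_ne_zero hj).trans (degree_le_vecDegree (G i) j)

theorem exists_minor_coeff_ne_zero (hG : IsRowReduced G d) :
    ∃ f : Fin k ↪o Fin n, (G.submatrix id f).det.coeff (∑ i, d i) ≠ 0 := by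
  obtain ⟨f, hf⟩ := exists_submatrix_det_ne_zero (M := Matrix.of fun i j => (G i j).coeff (d i))
    hG.linearIndependent
  refine ⟨f, ?_⟩
  rwa [coeff_det_sum (M := G.submatrix id f) fun i j => hG.natDegree_le i (f j)]

theorem overallConstraintLength_eq (hG : IsRowReduced G d) :
    overallConstraintLength G = (∑ i, d i : ℕ) := by
  refine le_antisymm (Finset.sup_le fun f _ => natDegree_le_iff_degree_le.mp
    (natDegree_det_le_sum fun i j => hG.natDegree_le i (f j))) ?_
  obtain ⟨f, hf⟩ := hG.exists_minor_coeff_ne_zero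
  exact (le_degree_of_ne_zero hf).trans
    (Finset.le_sup (f := fun f : Fin k ↪o Fin n => (G.submatrix id f).det.degree)
      (Finset.mem_univ f))

theorem rank_eq (hG : IsRowReduced G d) : G.rank = k := by
  obtain ⟨f, hf⟩ := hG.exists_minor_coeff_ne_zero
  have hdet : (G.submatrix id f).det ≠ 0 := fun h => hf (by rw [h, coeff_zero])
  refine le_antisymm G.rank_le_height ?_
  simpa [Matrix.rank_of_det_ne_zero hdet] using Matrix.rank_submatrix_le G id f

theorem isMinimal (hG : IsRowReduced G d) : IsMinimal G := by
  refine ⟨hG.rank_eq, ?_⟩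
  simp only [hG.overallConstraintLength_eq, hG.vecDegree_row, Nat.cast_sum]

/-- Forney's predictable degree property. -/
theorem degree_add_le_vecDegree_vecMul (hG : IsRowReduced G d) (w : Fin k → F[X]) (i : Fin k) :
    (w i).degree + d i ≤ vecDegree (Matrix.vecMul w G) := by
  have : Nonempty (Fin k) := ⟨i⟩
  obtain ⟨i₀, hmax⟩ := Finite.exists_max fun i => (w i).degree + d i
  refine (hmax i).trans ?_
  by_cases hi₀ : w i₀ = 0
  · simp [hi₀]
  set D := (w i₀).natDegree + d i₀
  have hD : ∀ i, (w i).degree + d i ≤ D := by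
    simpa [D, degree_eq_natDegree hi₀] using hmax
  have hcoeff : ∀ i j, (w i * G i j).coeff D = (w i).coeff (D - d i) * (G i j).coeff (d i) := by
    intro i j
    by_cases hi : w i = 0
    · simp [hi]
    have hi' : (w i).natDegree + d i ≤ D := by
      have := hD i
      rw [degree_eq_natDegree hi] at this
      exact_mod_cast this
    conv_lhs => rw [← Nat.sub_add_cancel (le_of_add_le_right hi')]
    exact coeff_mul_add_eq_of_natDegree_le (Nat.le_sub_of_add_le hi') (hG.natDegree_le i j)
  have hlead : (fun j => (Matrix.vecMul w G j).coeff D) ≠ 0 := by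
    intro h
    refine hi₀ (leadingCoeff_eq_zero.mp ?_)
    have := Fintype.linearIndependent_iff.mp hG.linearIndependent (fun i => (w i).coeff (D - d i))
      (by simpa [funext_iff, Matrix.vecMul, dotProduct, finsetSum_coeff, hcoeff] using h) i₀
    simpa [D] using this
  obtain ⟨j, hj⟩ := Function.ne_iff.mp hlead
  calc (w i₀).degree + d i₀ = D := by simp [D, degree_eq_natDegree hi₀]
    _ ≤ (Matrix.vecMul w G j).degree := le_degree_of_ne_zero hj
    _ ≤ vecDegree (Matrix.vecMul w G) := degree_le_vecDegree _ j

theorem vecMul_injective (hG : IsRowReduced G d) : Function.Injective G.vecMulLinear := by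
  rw [injective_iff_map_eq_zero]
  intro w hw
  funext i
  have hle := hG.degree_add_le_vecDegree_vecMul w i
  rw [← Matrix.vecMulLinear_apply, hw] at hle
  have hbot : vecDegree (0 : Fin n → F[X]) = ⊥ := by simp [vecDegree]
  simpa [hbot] using hle

theorem finrank_im (hG : IsRowReduced G d) : Module.finrank F[X] (im G) = k := by
  rw [im, LinearMap.finrank_range_of_inj hG.vecMul_injective, Module.finrank_fin_fun]

theorem isUnit_det_of_im_mul_eq (hG : IsRowReduced G d) {U : Matrix (Fin k) (Fin k) F[X]}
    (hU : im (U * G) = im G) : IsUnit U.det := by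
  obtain ⟨V, hV⟩ := exists_mul_eq_of_im_le hU.ge
  have hVU : V * U = 1 := funext fun i => hG.vecMul_injective <| by
    simpa [← Matrix.mul_apply_eq_vecMul, Matrix.mul_assoc] using congrFun hV i
  exact (Matrix.isUnit_iff_isUnit_det U).mp (IsUnit.of_mul_eq_one_right V hVU)

theorem map_vecDegree_eq_of_isMinimal (hG : IsRowReduced G d) {G' : Matrix (Fin k) (Fin n) F[X]}
    (hmin : IsMinimal G') (him : im G' = im G) :
    (Finset.univ.val.map fun i => vecDegree (G' i)) =
      Finset.univ.val.map fun i => (d i : WithBot ℕ) := by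
  obtain ⟨U, rfl⟩ := exists_mul_eq_of_im_le him.le
  have hU := hG.isUnit_det_of_im_mul_eq him
  obtain ⟨τ, hτ⟩ := exists_perm_forall_ne_zero hU.ne_zero
  have hle : ∀ i, (d i : WithBot ℕ) ≤ vecDegree ((U * G) (τ i)) := fun i =>
    (le_add_of_nonneg_left (zero_le_degree_iff.mpr (hτ i))).trans
      (hG.degree_add_le_vecDegree_vecMul (U (τ i)) i)
  have hsum : ∑ i, vecDegree ((U * G) (τ i)) = (∑ i, d i : ℕ) := by
    rw [Equiv.sum_comp τ fun i => vecDegree ((U * G) i), ← hmin.2,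
      overallConstraintLength_mul hU, hG.overallConstraintLength_eq]
  calc (Finset.univ.val.map fun i => vecDegree ((U * G) i))
      = (Finset.univ.val.map τ).map fun i => vecDegree ((U * G) i) := by
        rw [Multiset.map_univ_val_equiv]
    _ = Finset.univ.val.map fun i => (d i : WithBot ℕ) := by
        rw [Multiset.map_map]
        exact Multiset.map_congr rfl fun i _ => eq_of_sum_eq_sum_of_le hle hsum i

theorem isForneyIndices_iff (hG : IsRowReduced G d) {ν : Multiset (WithBot ℕ)} :
    IsForneyIndices (im G) ν ↔ ν = Finset.univ.val.map fun i => (d i : WithBot ℕ) := by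
  constructor
  · rintro ⟨l, G', hmin, him, rfl⟩
    obtain rfl : l = k := by
      rw [← hmin.1, ← hG.rank_eq]
      exact le_antisymm (rank_le_of_im_le him.le) (rank_le_of_im_le him.ge)
    exact hG.map_vecDegree_eq_of_isMinimal hmin him
  · rintro rfl
    exact ⟨k, G, hG.isMinimal, rfl, by simp only [hG.vecDegree_row]⟩

theorem isMemory_im (hG : IsRowReduced G d) {i : Fin k} (hi : ∀ j, d j ≤ d i) :
    IsMemory (im G) (d i) := by
  refine ⟨_, hG.isForneyIndices_iff.mpr rfl, ?_, fun e he => ?_⟩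
  · rw [Set.mem_ofPred_eq, Multiset.mem_map]
    exact ⟨i, Finset.mem_univ i, rfl⟩
  · rw [Set.mem_ofPred_eq, Multiset.mem_map] at he
    obtain ⟨j, -, rfl⟩ := he
    exact Nat.cast_le.mpr (hi j)

end IsRowReduced

end RowReduced

/-! ### Orthogonal translates in `A[z;σ]` -/

section ListProducts

variable {R κ : Type*} [Ring R]

theorem prod_map_mul_prod_map_reverse_eq_one {l : List κ} {f g : κ → R}
    (h : ∀ i ∈ l, f i * g i = 1) : (l.map f).prod * (l.reverse.map g).prod = 1 := by
  induction l with
  | nil => simp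
  | cons i l ih =>
    have ih' := ih fun j hj => h j (List.mem_cons_of_mem i hj)
    simp only [List.map_cons, List.prod_cons, List.reverse_cons, List.map_append, List.prod_append,
      List.map_nil, List.prod_nil, mul_one]
    rw [mul_assoc, ← mul_assoc (l.map f).prod, ih', one_mul, h i List.mem_cons_self]

theorem prod_map_reverse_one_sub {l : List κ} {t : κ → R}
    (h : l.Pairwise fun i j => t j * t i = 0) :
    (l.reverse.map fun i => 1 - t i).prod = 1 - (l.map t).sum := by
  induction l with
  | nil => simp
  | cons i l ih =>
    obtain ⟨hi, hl⟩ := List.pairwise_cons.mp h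
    have hsum : (l.map t).sum * t i = 0 := by
      rw [← List.sum_map_mul_right]
      exact List.sum_eq_zero fun x hx => by
        obtain ⟨j, hj, rfl⟩ := List.mem_map.mp hx
        exact hi j hj
    simp only [List.reverse_cons, List.map_append, List.prod_append, ih hl, List.map_cons,
      List.map_nil, List.prod_singleton, List.sum_cons]
    rw [sub_mul, one_mul, mul_sub, mul_one, hsum]
    abel

end ListProducts

namespace PiretAlgebra

variable {F A : Type*} [Field F] [CommRing A] [Algebra F A] (σ : A ≃ₐ[F] A)

instance : IsScalarTower F[X] (PiretAlgebra σ) (PiretAlgebra σ) :=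
  ⟨fun f a b => mul_assoc (polyHom σ f) a b⟩

theorem coe_smul (r : F) (a : A) : ι σ (r • a) = (C r : F[X]) • ι σ a := by
  have hC : polyHom σ (C r) = ι σ (algebraMap F A r) := by simp [polyHom]
  rw [smul_def, hC, Algebra.smul_def, map_mul]

theorem z_mul_coe_mul_z_mul_coe (a b : A) :
    z σ * ι σ a * (z σ * ι σ b) = z σ ^ 2 * ι σ (σ a * b) := by
  rw [mul_assoc, ← mul_assoc (ι σ a), coe_mul_z, mul_assoc, ← map_mul, ← mul_assoc, sq]

theorem coe_mul_z_pow (ν : ℕ) (a : A) : ι σ a * z σ ^ ν = z σ ^ ν * ι σ ((σ ^ ν) a) := by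
  induction ν with
  | zero => simp
  | succ ν ih =>
    rw [pow_succ (z σ), ← mul_assoc, ih, mul_assoc, coe_mul_z, mul_assoc, pow_succ' σ,
      AlgEquiv.mul_apply]

end PiretAlgebra

section OrthogonalTranslates

variable {F A : Type*} [Field F] [CommRing A] [Algebra F A] {σ : A ≃ₐ[F] A} {c : A} {m : ℕ}

theorem pow_apply_mul_pow_apply_eq_zero (horth : ∀ j, 1 ≤ j → j ≤ m → c * (σ ^ j) c = 0)
    {i j : ℕ} (hij : i < j) (hj : j ≤ i + m) : (σ ^ i) c * (σ ^ j) c = 0 := by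
  obtain ⟨d, rfl⟩ := Nat.exists_eq_add_of_le hij.le
  rw [pow_add, AlgEquiv.mul_apply, ← map_mul, horth d (by lia) (by lia), map_zero]

theorem pow_apply_mul_sum_eq_self (hidem : IsIdempotentElem c)
    (horth : ∀ j, 1 ≤ j → j ≤ m → c * (σ ^ j) c = 0) {i : ℕ} (hi : i ∈ Finset.Icc 1 m) :
    (σ ^ i) c * ∑ j ∈ Finset.Icc 1 m, (σ ^ j) c = (σ ^ i) c := by
  rw [Finset.mul_sum, Finset.sum_eq_single_of_mem i hi, ← map_mul, hidem.eq]
  intro j hj hne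
  rw [Finset.mem_Icc] at hi hj
  rcases hne.lt_or_gt with hlt | hlt
  · rw [mul_comm, pow_apply_mul_pow_apply_eq_zero horth hlt (by lia)]
  · exact pow_apply_mul_pow_apply_eq_zero horth hlt (by lia)

theorem pow_succ_apply_mul_sum_eq_zero (horth : ∀ j, 1 ≤ j → j ≤ m → c * (σ ^ j) c = 0) :
    (σ ^ (m + 1)) c * ∑ j ∈ Finset.Icc 1 m, (σ ^ j) c = 0 := by
  rw [Finset.mul_sum]
  refine Finset.sum_eq_zero fun j hj => ?_
  rw [Finset.mem_Icc] at hj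
  rw [mul_comm, pow_apply_mul_pow_apply_eq_zero horth (by lia) (by lia)]

open PiretAlgebra in
theorem z_mul_coe_mul_z_mul_coe_eq_zero (horth : ∀ j, 1 ≤ j → j ≤ m → c * (σ ^ j) c = 0)
    {i j : ℕ} (hj : 1 ≤ j) (hji : j ≤ i) (hi : i ≤ m) :
    z σ * ι σ ((σ ^ i) c) * (z σ * ι σ ((σ ^ j) c)) = 0 := by
  rw [z_mul_coe_mul_z_mul_coe, ← AlgEquiv.mul_apply, ← pow_succ', mul_comm ((σ ^ (i + 1)) c),
    pow_apply_mul_pow_apply_eq_zero horth (by lia) (by lia), map_zero, mul_zero]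

end OrthogonalTranslates

section Generator

open PiretAlgebra

variable {F : Type*} [Field F] {n : ℕ} (σ : CyclicAlgebra F n ≃ₐ[F] CyclicAlgebra F n)
  (c : CyclicAlgebra F n)

theorem genPoly_eq_coe_mul_sum (m : ℕ) :
    genPoly σ c m = ι σ c * ∑ ν ∈ Finset.range (m + 1), z σ ^ ν := by
  simp only [genPoly, Finset.mul_sum, coe_mul_z_pow]

theorem coe_mul_genPoly (m : ℕ) (a : CyclicAlgebra F n) :
    ι σ a * genPoly σ c m = genPoly σ (a * c) m := by
  rw [genPoly_eq_coe_mul_sum, genPoly_eq_coe_mul_sum, map_mul, mul_assoc]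

variable {σ c} {m : ℕ}

theorem genUnit_eq_one_sub (horth : ∀ j, 1 ≤ j → j ≤ m → c * (σ ^ j) c = 0) :
    genUnit σ c m = 1 - z σ * ι σ (∑ ν ∈ Finset.Icc 1 m, (σ ^ ν) c) := by
  have hpair : (List.range' 1 m).Pairwise fun i j =>
      z σ * ι σ ((σ ^ j) c) * (z σ * ι σ ((σ ^ i) c)) = 0 :=
    List.Pairwise.imp_of_mem (fun hi hj hij => by
      rw [List.mem_range'_1] at hi hj
      exact z_mul_coe_mul_z_mul_coe_eq_zero horth hi.1 (le_of_lt hij) (by lia))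
      List.pairwise_lt_range'
  rw [genUnit, prod_map_reverse_one_sub hpair, map_sum, Finset.mul_sum]
  rfl

theorem one_add_mul_one_sub_eq_one (horth : ∀ j, 1 ≤ j → j ≤ m → c * (σ ^ j) c = 0) {ν : ℕ}
    (hν : ν ∈ List.range' 1 m) :
    (1 + z σ * ι σ ((σ ^ ν) c)) * (1 - z σ * ι σ ((σ ^ ν) c)) = 1 := by
  rw [List.mem_range'_1] at hν
  rw [mul_one_sub, one_add_mul, z_mul_coe_mul_z_mul_coe_eq_zero horth hν.1 le_rfl (by lia)]
  abel

theorem prod_mul_genUnit (horth : ∀ j, 1 ≤ j → j ≤ m → c * (σ ^ j) c = 0) :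
    ((List.range' 1 m).map fun ν => 1 + z σ * ι σ ((σ ^ ν) c)).prod * genUnit σ c m = 1 :=
  prod_map_mul_prod_map_reverse_eq_one fun _ hν => one_add_mul_one_sub_eq_one horth hν

theorem genUnit_mul_prod (horth : ∀ j, 1 ≤ j → j ≤ m → c * (σ ^ j) c = 0) :
    genUnit σ c m * ((List.range' 1 m).map fun ν => 1 + z σ * ι σ ((σ ^ ν) c)).prod = 1 := by
  have h := prod_map_mul_prod_map_reverse_eq_one (l := (List.range' 1 m).reverse)
    (f := fun ν => 1 - z σ * ι σ ((σ ^ ν) c)) (g := fun ν => 1 + z σ * ι σ ((σ ^ ν) c))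
    fun ν hν => ?_
  · rwa [List.reverse_reverse] at h
  · have hcomm : Commute (1 + z σ * ι σ ((σ ^ ν) c)) (1 - z σ * ι σ ((σ ^ ν) c)) :=
      (Commute.one_left _).add_left ((Commute.one_right _).sub_right (Commute.refl _))
    rw [← hcomm.eq, one_add_mul_one_sub_eq_one horth (List.mem_reverse.mp hν)]

theorem isUnit_genUnit (horth : ∀ j, 1 ≤ j → j ≤ m → c * (σ ^ j) c = 0) :
    IsUnit (genUnit σ c m) :=
  ⟨⟨_, _, genUnit_mul_prod horth, prod_mul_genUnit horth⟩, rfl⟩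

theorem genPoly_mul_genUnit (hidem : IsIdempotentElem c)
    (horth : ∀ j, 1 ≤ j → j ≤ m → c * (σ ^ j) c = 0) :
    genPoly σ c m * genUnit σ c m = ι σ c := by
  set s := ∑ ν ∈ Finset.Icc 1 m, (σ ^ ν) c with hs
  have hterm : ∀ ν, z σ ^ ν * ι σ ((σ ^ ν) c) * (z σ * ι σ s) =
      z σ ^ (ν + 1) * ι σ ((σ ^ (ν + 1)) c * s) := fun ν => by
    rw [mul_assoc, ← mul_assoc (ι σ _), coe_mul_z, mul_assoc, ← map_mul, ← mul_assoc, ← pow_succ,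
      ← AlgEquiv.mul_apply, ← pow_succ']
  have hshift : genPoly σ c m * (z σ * ι σ s) =
      ∑ ν ∈ Finset.range m, z σ ^ (ν + 1) * ι σ ((σ ^ (ν + 1)) c) := by
    rw [genPoly, Finset.sum_mul, Finset.sum_congr rfl fun ν _ => hterm ν, Finset.sum_range_succ,
      pow_succ_apply_mul_sum_eq_zero horth, map_zero, mul_zero, add_zero]
    refine Finset.sum_congr rfl fun ν hν => ?_
    rw [pow_apply_mul_sum_eq_self hidem horth
      (Finset.mem_Icc.mpr ⟨by lia, Finset.mem_range.mp hν⟩)]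
  rw [genUnit_eq_one_sub horth, ← hs, mul_one_sub, hshift, genPoly, Finset.sum_range_succ']
  simp

theorem genPoly_eq_coe_mul_prod (hidem : IsIdempotentElem c)
    (horth : ∀ j, 1 ≤ j → j ≤ m → c * (σ ^ j) c = 0) :
    genPoly σ c m =
      ι σ c * ((List.range' 1 m).map fun ν => 1 + z σ * ι σ ((σ ^ ν) c)).prod := by
  rw [← genPoly_mul_genUnit hidem horth, mul_assoc, genUnit_mul_prod horth, mul_one]

end Generator

/-! ### The generator matrix -/

section LocalMinpoly

variable {F A M : Type*} [Field F] [Ring A] [Algebra F A] [AddCommGroup M] [Module A M]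

/-- A minimal polynomial of `v` with respect to `x`: a generator, not normalized to be monic, of
the ideal of all polynomials `f` with `f(x) v = 0`. It is `0` if only `f = 0` has this property. -/
noncomputable def localMinpoly (F : Type*) [Field F] [Algebra F A] (x : A) (v : M) : F[X] :=
  Submodule.IsPrincipal.generator ((Ideal.torsionOf A M v).comap (aeval (R := F) x))

variable {x : A} {v : M}

theorem localMinpoly_dvd_iff {f : F[X]} : localMinpoly F x v ∣ f ↔ aeval x f • v = 0 := by
  rw [localMinpoly, ← Submodule.IsPrincipal.mem_iff_generator_dvd, Ideal.mem_comap,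
    Ideal.mem_torsionOf_iff]

theorem localMinpoly_ne_zero (hx : IsIntegral F x) : localMinpoly F x v ≠ 0 := by
  have hdvd : localMinpoly F x v ∣ minpoly F x :=
    localMinpoly_dvd_iff.mpr (by rw [minpoly.aeval, zero_smul])
  exact ne_zero_of_dvd_ne_zero (minpoly.ne_zero hx) hdvd

variable [Module F M] [IsScalarTower F A M]

theorem linearIndependent_pow_smul :
    LinearIndependent F fun i : Fin (localMinpoly F x v).natDegree => x ^ (i : ℕ) • v := by
  rw [Fintype.linearIndependent_iff]
  intro g hg i
  have hdvd : localMinpoly F x v ∣ ∑ i, C (g i) * X ^ (i : ℕ) := by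
    rw [localMinpoly_dvd_iff, ← hg]
    simp [Finset.sum_smul, ← Algebra.smul_def]
  have hzero : ∑ i, C (g i) * X ^ (i : ℕ) = 0 :=
    eq_zero_of_dvd_of_degree_lt hdvd <| (degree_sum_fin_lt g).trans_eq
      (degree_eq_natDegree (ne_zero_of_natDegree_gt i.pos)).symm
  simpa [finsetSum_coeff, coeff_X_pow, ← Fin.ext_iff] using congrArg (coeff · (i : ℕ)) hzero

theorem aeval_smul_mem_span_pow_smul (hx : IsIntegral F x) (f : F[X]) :
    aeval x f • v ∈ Submodule.span F
      (Set.range fun i : Fin (localMinpoly F x v).natDegree => x ^ (i : ℕ) • v) := by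
  set h := localMinpoly F x v
  have hmod : aeval x f • v = aeval x (f % h) • v := by
    rw [← sub_eq_zero, ← sub_smul, ← map_sub, ← localMinpoly_dvd_iff]
    exact ⟨f / h, sub_eq_of_eq_add (EuclideanDomain.div_add_mod f h).symm⟩
  rw [hmod]
  by_cases hf : f % h = 0
  · rw [hf, map_zero, zero_smul]
    exact Submodule.zero_mem _
  have hlt : (f % h).natDegree < h.natDegree :=
    natDegree_lt_natDegree hf (EuclideanDomain.mod_lt f (localMinpoly_ne_zero hx))
  rw [aeval_eq_sum_range' hlt, Finset.sum_smul]
  refine Submodule.sum_mem _ fun i hi => ?_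
  rw [smul_assoc]
  exact Submodule.smul_mem _ _ (Submodule.subset_span ⟨⟨i, Finset.mem_range.mp hi⟩, rfl⟩)

theorem span_range_pow_smul (hx : IsIntegral F x)
    (hgen : Function.Surjective (aeval (R := F) x)) :
    Submodule.span F
      (Set.range fun i : Fin (localMinpoly F x v).natDegree => x ^ (i : ℕ) • v) =
      (Submodule.span A {v}).restrictScalars F := by
  refine le_antisymm (Submodule.span_le.mpr ?_) fun y hy => ?_
  · rintro _ ⟨i, rfl⟩
    exact Submodule.smul_mem _ _ (Submodule.mem_span_singleton_self v)
  · obtain ⟨a, rfl⟩ := Submodule.mem_span_singleton.mp hy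
    obtain ⟨f, rfl⟩ := hgen a
    exact aeval_smul_mem_span_pow_smul hx f

end LocalMinpoly

section CyclicShifts

variable {F : Type*} [Field F] {n : ℕ}

theorem CyclicAlgebra.aeval_x_surjective :
    Function.Surjective (aeval (R := F) (CyclicAlgebra.x F n)) := by
  simpa only [AdjoinRoot.aeval_eq, Function.Surjective] using AdjoinRoot.mk_surjective

variable [NeZero n]

instance : FiniteDimensional F (CyclicAlgebra F n) :=
  Module.Finite.equiv (p₀ F n)

variable (c : CyclicAlgebra F n)

theorem span_shifts_localMinpoly :
    Submodule.span F (Set.range fun i : Fin (localMinpoly F (CyclicAlgebra.x F n) c).natDegree =>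
      CyclicAlgebra.x F n ^ (i : ℕ) * c) = (Ideal.span {c}).restrictScalars F :=
  span_range_pow_smul (.of_finite F _) CyclicAlgebra.aeval_x_surjective

theorem blockDim_eq_natDegree :
    blockDim c = (localMinpoly F (CyclicAlgebra.x F n) c).natDegree := by
  rw [blockDim, ← span_shifts_localMinpoly]
  exact (finrank_span_eq_card linearIndependent_pow_smul).trans (Fintype.card_fin _)

theorem linearIndependent_shifts :
    LinearIndependent F fun i : Fin (blockDim c) => CyclicAlgebra.x F n ^ (i : ℕ) * c := by
  rw [blockDim_eq_natDegree]
  exact linearIndependent_pow_smul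

theorem span_shifts :
    Submodule.span F (Set.range fun i : Fin (blockDim c) => CyclicAlgebra.x F n ^ (i : ℕ) * c) =
      (Ideal.span {c}).restrictScalars F := by
  rw [blockDim_eq_natDegree, span_shifts_localMinpoly]

variable {c}

theorem blockDim_pos (hc : c ≠ 0) : 0 < blockDim c := by
  refine Submodule.one_le_finrank_iff.mpr fun h => hc ?_
  rw [Submodule.restrictScalars_eq_bot_iff] at h
  exact Ideal.span_singleton_eq_bot.mp h

end CyclicShifts

section GeneratorMatrix

open PiretAlgebra

variable {F : Type*} [Field F] {n : ℕ} [NeZero n]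
  (σ : CyclicAlgebra F n ≃ₐ[F] CyclicAlgebra F n)

theorem p_monomial (ν : ℕ) (a : CyclicAlgebra F n) :
    p σ (fun j => monomial ν (v₀ F n a j)) = z σ ^ ν * ι σ a :=
  (pLin_monomial σ ν (v₀ F n a)).trans <| by rw [v₀, LinearEquiv.apply_symm_apply]

theorem v_coe (a : CyclicAlgebra F n) : v σ (ι σ a) = fun j => C (v₀ F n a j) := by
  rw [v, LinearEquiv.symm_apply_eq]
  simpa using (p_monomial σ 0 a).symm

variable (c : CyclicAlgebra F n) (m : ℕ)

theorem genMatrix_apply (i : Fin (blockDim c)) (j : Fin n) :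
    genMatrix σ c m i j = ∑ ν ∈ Finset.range (m + 1), monomial ν (coeffMatrix σ c ν i j) := by
  rw [genMatrix, Matrix.sum_apply]
  refine Finset.sum_congr rfl fun ν _ => ?_
  rw [Matrix.smul_apply, Matrix.map_apply, smul_eq_mul, X_pow_mul, C_mul_X_pow_eq_monomial]

theorem linearIndependent_coeffMatrix (ν : ℕ) : LinearIndependent F (coeffMatrix σ c ν).row :=
  (linearIndependent_shifts c).map' (((σ ^ ν).toLinearEquiv.trans (v₀ F n)).toLinearMap)
    (LinearEquiv.ker _)

theorem isRowReduced_genMatrix : IsRowReduced (genMatrix σ c m) fun _ => m where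
  natDegree_le i j := by
    rw [genMatrix_apply]
    exact natDegree_sum_le_of_forall_le _ _ fun ν hν =>
      (natDegree_monomial_le _).trans (Finset.mem_range_succ_iff.mp hν)
  linearIndependent := by
    have hlead : (fun i j => (genMatrix σ c m i j).coeff m) = (coeffMatrix σ c m).row := by
      ext i j
      simp [genMatrix_apply, finsetSum_coeff, coeff_monomial]
    rw [hlead]
    exact linearIndependent_coeffMatrix σ c m

theorem p_genMatrix_row (i : Fin (blockDim c)) :
    p σ (genMatrix σ c m i) = ι σ (CyclicAlgebra.x F n ^ (i : ℕ)) * genPoly σ c m := by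
  have hrow : genMatrix σ c m i = ∑ ν ∈ Finset.range (m + 1), fun j =>
      monomial ν (v₀ F n ((σ ^ ν) (CyclicAlgebra.x F n ^ (i : ℕ) * c)) j) := by
    funext j
    rw [genMatrix_apply, Finset.sum_apply]
    rfl
  rw [hrow, map_sum, coe_mul_genPoly]
  exact Finset.sum_congr rfl fun ν _ => p_monomial σ ν _

variable {c}

theorem coe_mul_genPoly_mem_map_im (hidem : IsIdempotentElem c) (a : CyclicAlgebra F n) :
    ι σ a * genPoly σ c m ∈ (im (genMatrix σ c m)).map (p σ).toLinearMap := by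
  have hc : ι σ c * genPoly σ c m = genPoly σ c m := by rw [coe_mul_genPoly, hidem.eq]
  have hac : a * c ∈ Submodule.span F
      (Set.range fun i : Fin (blockDim c) => CyclicAlgebra.x F n ^ (i : ℕ) * c) := by
    rw [span_shifts]
    exact Ideal.mul_mem_left _ a (Ideal.mem_span_singleton_self c)
  rw [← hc, ← mul_assoc, ← map_mul]
  generalize a * c = y at hac ⊢
  induction hac using Submodule.span_induction with
  | mem _ h =>
    obtain ⟨i, rfl⟩ := h
    rw [map_mul, mul_assoc, hc, ← p_genMatrix_row, im_eq_span_rows]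
    exact Submodule.mem_map_of_mem (Submodule.subset_span (Set.mem_range_self i))
  | zero => simp
  | add x y _ _ hx hy =>
    rw [map_add, add_mul]
    exact Submodule.add_mem _ hx hy
  | smul r x _ hx =>
    rw [PiretAlgebra.coe_smul, smul_mul_assoc]
    exact Submodule.smul_mem _ _ hx

theorem map_im_genMatrix (hidem : IsIdempotentElem c) :
    (im (genMatrix σ c m)).map (p σ).toLinearMap =
      (Ideal.span {genPoly σ c m}).restrictScalars F[X] := by
  refine le_antisymm ?_ fun y hy => ?_
  · rw [im_eq_span_rows, Submodule.map_span, Submodule.span_le]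
    rintro _ ⟨_, ⟨i, rfl⟩, rfl⟩
    exact Ideal.mem_span_singleton'.mpr ⟨_, (p_genMatrix_row σ c m i).symm⟩
  · obtain ⟨f, rfl⟩ := Ideal.mem_span_singleton'.mp hy
    obtain ⟨a, rfl⟩ := (p σ).surjective f
    have ha : p σ a = ∑ j, a j • ι σ (CyclicAlgebra.x F n ^ (j : ℕ)) := rfl
    rw [ha, Finset.sum_mul]
    refine Submodule.sum_mem _ fun j _ => ?_
    rw [smul_mul_assoc]
    exact Submodule.smul_mem _ _ (coe_mul_genPoly_mem_map_im σ m hidem _)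

theorem image_p_im_genMatrix (hidem : IsIdempotentElem c) :
    p σ '' im (genMatrix σ c m) = (Ideal.span {genPoly σ c m} : Ideal (PiretAlgebra σ)) :=
  congrArg SetLike.coe (map_im_genMatrix σ m hidem)

theorem im_genMatrix_eq_image_v (hidem : IsIdempotentElem c) :
    (im (genMatrix σ c m) : Set (Fin n → F[X])) =
      v σ '' (Ideal.span {genPoly σ c m} : Ideal (PiretAlgebra σ)) := by
  rw [← image_p_im_genMatrix σ m hidem]
  exact ((p σ).toEquiv.symm_image_image _).symm

theorem isSigmaCyclic_im_genMatrix (hidem : IsIdempotentElem c) :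
    IsSigmaCyclic σ (im (genMatrix σ c m)) :=
  ⟨_, (image_p_im_genMatrix σ m hidem).symm⟩

variable {σ m}

theorem rightInvertible_genMatrix {u : PiretAlgebra σ} (hu : genPoly σ c m * u = ι σ c) :
    RightInvertible (genMatrix σ c m) := by
  obtain ⟨H, hH⟩ := exists_mul_eq_one (linearIndependent_coeffMatrix σ c 0)
  have hrow : ∀ i, v σ (p σ (genMatrix σ c m i) * u) = (coeffMatrix σ c 0).map C i := fun i => by
    rw [p_genMatrix_row, mul_assoc, hu, ← map_mul, v_coe]
    rfl
  refine rightInvertible_of_linearMap ((H.map C).vecMulLinear ∘ₗ (v σ).toLinearMap ∘ₗ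
    LinearMap.mulRight F[X] u ∘ₗ (p σ).toLinearMap) fun i => ?_
  calc Matrix.vecMul (v σ (p σ (genMatrix σ c m i) * u)) (H.map C)
      = ((coeffMatrix σ c 0 * H).map C) i := by
        rw [hrow, ← Matrix.mul_apply_eq_vecMul, Matrix.map_mul]
    _ = Pi.single i 1 := by
        rw [hH, Matrix.map_one C C_0 C_1]
        exact funext fun j => Matrix.one_eq_pi_single

end GeneratorMatrix

/-! ### Sums of primitive idempotents -/

section PrimitiveIdempotents

variable {A : Type*} [CommRing A] {ε ε' : A} {S : Finset A}

/-- `ε` is a primitive idempotent of a commutative ring, with `ε = 0` allowed: the only idempotents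
in the ideal `⟨ε⟩`, which are the products `f * ε` with `f` idempotent, are `0` and `ε`. -/
structure IsPrimitiveIdempotent (ε : A) : Prop where
  isIdempotentElem : IsIdempotentElem ε
  mul_eq_zero_or_mul_eq_self {f : A} : IsIdempotentElem f → f * ε = 0 ∨ f * ε = ε

namespace IsPrimitiveIdempotent

theorem map {B : Type*} [CommRing B] (h : IsPrimitiveIdempotent ε) (e : A ≃+* B) :
    IsPrimitiveIdempotent (e ε) := by
  refine ⟨h.isIdempotentElem.map e, fun {f} hf => ?_⟩
  refine (h.mul_eq_zero_or_mul_eq_self (hf.map e.symm)).imp (fun h0 => ?_) fun h1 => ?_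
  · simpa using congrArg e h0
  · simpa using congrArg e h1

theorem mul_eq_zero_of_ne (h : IsPrimitiveIdempotent ε) (h' : IsPrimitiveIdempotent ε')
    (hne : ε ≠ ε') : ε * ε' = 0 := by
  rcases h.mul_eq_zero_or_mul_eq_self h'.isIdempotentElem with h0 | h1
  · rwa [mul_comm]
  · refine (h'.mul_eq_zero_or_mul_eq_self h.isIdempotentElem).resolve_right fun h1' => hne ?_
    rw [← h1, mul_comm, h1']

theorem mul_sum_eq_self (hS : ∀ ε ∈ S, IsPrimitiveIdempotent ε) (hε : ε ∈ S) :
    ε * ∑ ε' ∈ S, ε' = ε := by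
  rw [Finset.mul_sum, Finset.sum_eq_single_of_mem ε hε fun ε' hε' hne =>
    (hS ε hε).mul_eq_zero_of_ne (hS ε' hε') hne.symm, (hS ε hε).isIdempotentElem.eq]

theorem isIdempotentElem_sum (hS : ∀ ε ∈ S, IsPrimitiveIdempotent ε) :
    IsIdempotentElem (∑ ε ∈ S, ε) := by
  rw [IsIdempotentElem, Finset.sum_mul]
  exact Finset.sum_congr rfl fun ε hε => mul_sum_eq_self hS hε

theorem sum_ne_zero (hS : ∀ ε ∈ S, IsPrimitiveIdempotent ε) (hε : ε ∈ S) (hε0 : ε ≠ 0) :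
    ∑ ε ∈ S, ε ≠ 0 :=
  right_ne_zero_of_mul (a := ε) (by rwa [mul_sum_eq_self hS hε])

theorem sum_mul_map_sum_eq_zero (hS : ∀ ε ∈ S, IsPrimitiveIdempotent ε) (e : A ≃+* A)
    (hdisj : Disjoint (S : Set A) (e '' S)) : (∑ ε ∈ S, ε) * e (∑ ε ∈ S, ε) = 0 := by
  rw [map_sum, Finset.sum_mul_sum]
  refine Finset.sum_eq_zero fun ε hε => Finset.sum_eq_zero fun ε' hε' => ?_
  exact (hS ε hε).mul_eq_zero_of_ne ((hS ε' hε').map e) <|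
    hdisj.ne_of_mem hε (Set.mem_image_of_mem e hε')

end IsPrimitiveIdempotent

end PrimitiveIdempotents

section CyclicIdempotents

variable {F : Type*} [Field F] {n : ℕ}

theorem mk_dvd_mk_iff {R : Type*} [CommRing R] {π q f : R[X]} (hπ : π ∣ q) :
    AdjoinRoot.mk q π ∣ AdjoinRoot.mk q f ↔ π ∣ f := by
  refine ⟨fun ⟨a, ha⟩ => ?_, map_dvd _⟩
  obtain ⟨r, rfl⟩ := AdjoinRoot.mk_surjective a
  rw [← map_mul, AdjoinRoot.mk_eq_mk] at ha
  exact (dvd_sub_left (dvd_mul_right π r)).mp (hπ.trans ha)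

theorem not_mk_dvd_one {π : F[X]} (hπ : π ∈ primeFactors F n) :
    ¬ AdjoinRoot.mk (X ^ n - 1) π ∣ 1 := by
  rw [← map_one (AdjoinRoot.mk (X ^ n - 1 : F[X])), mk_dvd_mk_iff hπ.2.2]
  exact hπ.2.1.not_dvd_one

theorem mk_dvd_or_mk_dvd {π : F[X]} (hπ : π ∈ primeFactors F n) {a b : CyclicAlgebra F n}
    (hab : AdjoinRoot.mk (X ^ n - 1) π ∣ a * b) :
    AdjoinRoot.mk (X ^ n - 1) π ∣ a ∨ AdjoinRoot.mk (X ^ n - 1) π ∣ b := by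
  obtain ⟨f, rfl⟩ := AdjoinRoot.mk_surjective a
  obtain ⟨g, rfl⟩ := AdjoinRoot.mk_surjective b
  rw [← map_mul] at hab
  simp only [mk_dvd_mk_iff hπ.2.2] at hab ⊢
  exact hπ.2.1.prime.dvd_or_dvd hab

theorem ne_zero_of_mem_primitiveIdempotents {ε : CyclicAlgebra F n}
    (hε : ε ∈ primitiveIdempotents F n) : ε ≠ 0 := by
  rintro rfl
  obtain ⟨π, hπ, h1, -⟩ := hε
  rw [zero_sub, dvd_neg] at h1
  exact not_mk_dvd_one hπ h1

theorem eq_zero_of_forall_primeFactors_dvd (hn : ¬ ringChar F ∣ n) {a : CyclicAlgebra F n}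
    (ha : ∀ π ∈ primeFactors F n, AdjoinRoot.mk (X ^ n - 1) π ∣ a) : a = 0 := by
  classical
  obtain ⟨f, rfl⟩ := AdjoinRoot.mk_surjective a
  have hsq : Squarefree (X ^ n - 1 : F[X]) :=
    (X_pow_sub_one_separable_iff.mpr fun h => hn ((ringChar.spec F n).mp h)).squarefree
  rw [AdjoinRoot.mk_eq_zero]
  refine (hsq.isRadical.dvd_radical hsq.ne_zero).trans <|
    Finset.prod_dvd_of_isRelPrime UniqueFactorizationMonoid.pairwise_primeFactors_isRelPrime
      fun π hπ => ?_
  rw [UniqueFactorizationMonoid.mem_primeFactors,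
    UniqueFactorizationMonoid.mem_normalizedFactors_iff' hsq.ne_zero] at hπ
  obtain ⟨hirr, hnorm, hdvd⟩ := hπ
  exact (mk_dvd_mk_iff hdvd).mp
    (ha π ⟨hnorm ▸ monic_normalize hirr.ne_zero, hirr, hdvd⟩)

theorem isPrimitiveIdempotent_of_mem (hn : ¬ ringChar F ∣ n) {ε : CyclicAlgebra F n}
    (hε : ε ∈ primitiveIdempotents F n) : IsPrimitiveIdempotent ε := by
  obtain ⟨π, hπ, h1, h0⟩ := hε
  have hmul : ∀ {a}, AdjoinRoot.mk (X ^ n - 1) π ∣ a → a * ε = 0 := fun {a} ha => by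
    refine eq_zero_of_forall_primeFactors_dvd hn fun π' hπ' => ?_
    rcases eq_or_ne π' π with rfl | hne
    · exact ha.mul_right ε
    · exact (h0 π' hπ' hne).mul_left a
  refine ⟨sub_eq_zero.mp ?_, fun {f} hf => ?_⟩
  · simpa [sub_mul] using hmul h1
  · have hfac : AdjoinRoot.mk (X ^ n - 1) π ∣ f * (f - 1) := by
      rw [mul_sub_one, hf.eq, sub_self]
      exact dvd_zero _
    refine (mk_dvd_or_mk_dvd hπ hfac).imp hmul fun hf1 => sub_eq_zero.mp ?_
    simpa [sub_mul] using hmul hf1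

end CyclicIdempotents

end DoublyCyclicCode

open PiretAlgebra in
theorem theorem3p3_general {F : Type*} [Field F] {n : ℕ} [NeZero n]
    (σ : CyclicAlgebra F n ≃ₐ[F] CyclicAlgebra F n) {c : CyclicAlgebra F n} {m : ℕ}
    (hc0 : c ≠ 0) (hidem : IsIdempotentElem c)
    (horth : ∀ j, 1 ≤ j → j ≤ m → c * (σ ^ j) c = 0) :
    (genPoly σ c m = ι σ c * ∑ ν ∈ Finset.range (m + 1), z σ ^ ν ∧
      genPoly σ c m = ι σ c * ((List.range' 1 m).map fun ν =>
        1 + z σ * ι σ ((σ ^ ν) c)).prod) ∧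
    (genPoly σ c m * genUnit σ c m = ι σ c ∧
      IsUnit (genUnit σ c m) ∧
      genUnit σ c m =
        1 - z σ * ι σ (∑ ν ∈ Finset.Icc 1 m, (σ ^ ν) c)) ∧
    ((im (genMatrix σ c m) : Set (Fin n → F[X])) =
        v σ '' (Ideal.span {genPoly σ c m} : Ideal (PiretAlgebra σ)) ∧
      IsSigmaCyclic σ (im (genMatrix σ c m)) ∧
      Module.finrank F[X] (im (genMatrix σ c m)) = blockDim c) ∧
    ((∃ D : Submodule F[X] (Fin n → F[X]), IsCompl (im (genMatrix σ c m)) D) ∧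
      RightInvertible (genMatrix σ c m)) ∧
    IsMinimal (genMatrix σ c m) ∧
    (IsConvolutionalCode (im (genMatrix σ c m)) (blockDim c) (blockDim c * m) ∧
      IsMemory (im (genMatrix σ c m)) m ∧
      ∀ ν : Multiset (WithBot ℕ), IsForneyIndices (im (genMatrix σ c m)) ν ↔
        ν = Multiset.replicate (blockDim c) (m : WithBot ℕ)) := by
  have hgu := genPoly_mul_genUnit hidem horth
  have hinv := rightInvertible_genMatrix hgu
  have hred := isRowReduced_genMatrix σ c m
  have hlength : overallConstraintLength (genMatrix σ c m) = (blockDim c * m : ℕ) := by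
    simpa using hred.overallConstraintLength_eq
  have hForney : ∀ ν, IsForneyIndices (im (genMatrix σ c m)) ν ↔
      ν = Multiset.replicate (blockDim c) (m : WithBot ℕ) := fun ν => by
    simpa using hred.isForneyIndices_iff (ν := ν)
  exact ⟨⟨genPoly_eq_coe_mul_sum σ c m, genPoly_eq_coe_mul_prod hidem horth⟩,
    ⟨hgu, isUnit_genUnit horth, genUnit_eq_one_sub horth⟩,
    ⟨im_genMatrix_eq_image_v σ m hidem, isSigmaCyclic_im_genMatrix σ m hidem, hred.finrank_im⟩,
    ⟨hinv.exists_isCompl, hinv⟩,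
    hred.isMinimal,
    ⟨_, hinv, rfl, hlength⟩,
    hred.isMemory_im (i := ⟨0, blockDim_pos hc0⟩) fun _ => le_rfl,
    hForney⟩

theorem theorem3p3 {F : Type*} [Field F] [Finite F] (n : ℕ) [NeZero n]
    (hchar : ¬ ringChar F ∣ n)
    (σ : CyclicAlgebra F n ≃ₐ[F] CyclicAlgebra F n)
    (S : Finset (CyclicAlgebra F n)) (hS : S.Nonempty)
    (hSE : (S : Set (CyclicAlgebra F n)) ⊆ primitiveIdempotents F n)
    (b m : ℕ)
    (hdisj : ∀ j, 1 ≤ j → j ≤ b →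
      Disjoint (S : Set (CyclicAlgebra F n)) ((σ ^ j) '' (S : Set (CyclicAlgebra F n))))
    (hm : 1 ≤ m) (hmb : m ≤ b)
    (c : CyclicAlgebra F n) (hc : c = ∑ ε ∈ S, ε)
    (k : ℕ) (hk : k = blockDim c) :
    -- (a)
    (genPoly σ c m = PiretAlgebra.ι σ c * ∑ ν ∈ Finset.range (m + 1), PiretAlgebra.z σ ^ ν ∧
      genPoly σ c m = PiretAlgebra.ι σ c * ((List.range' 1 m).map fun ν =>
        1 + PiretAlgebra.z σ * PiretAlgebra.ι σ ((σ ^ ν) c)).prod) ∧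
    -- (b)
    (genPoly σ c m * genUnit σ c m = PiretAlgebra.ι σ c ∧
      IsUnit (genUnit σ c m) ∧
      genUnit σ c m =
        1 - PiretAlgebra.z σ * PiretAlgebra.ι σ (∑ ν ∈ Finset.Icc 1 m, (σ ^ ν) c)) ∧
    -- (c)
    ((im (genMatrix σ c m) : Set (Fin n → Polynomial F)) =
        v σ '' (Ideal.span {genPoly σ c m} : Ideal (PiretAlgebra σ)) ∧
      IsSigmaCyclic σ (im (genMatrix σ c m)) ∧
      Module.finrank (Polynomial F) (im (genMatrix σ c m)) = k) ∧
    -- (d)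
    ((∃ D : Submodule (Polynomial F) (Fin n → Polynomial F), IsCompl (im (genMatrix σ c m)) D) ∧
      RightInvertible (genMatrix σ c m)) ∧
    -- (e)
    IsMinimal (genMatrix σ c m) ∧
    -- (f)
    (IsConvolutionalCode (im (genMatrix σ c m)) k (k * m) ∧
      IsMemory (im (genMatrix σ c m)) m ∧
      ∀ ν : Multiset (WithBot ℕ), IsForneyIndices (im (genMatrix σ c m)) ν ↔
        ν = Multiset.replicate k (m : WithBot ℕ)) := by
  have hprim : ∀ ε ∈ S, IsPrimitiveIdempotent ε := fun ε hε =>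
    isPrimitiveIdempotent_of_mem hchar (hSE hε)
  obtain ⟨ε, hε⟩ := hS
  subst hc hk
  exact theorem3p3_general σ
    (IsPrimitiveIdempotent.sum_ne_zero hprim hε (ne_zero_of_mem_primitiveIdempotents (hSE hε)))
    (IsPrimitiveIdempotent.isIdempotentElem_sum hprim) fun j h1 hj =>
      IsPrimitiveIdempotent.sum_mul_map_sum_eq_zero hprim (σ ^ j).toRingEquiv
        (hdisj j h1 (hj.trans hmb))
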